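/- Let $A\in\mathbb R^{n_x\times n_x}$, $B\in\mathbb R^{n_x\times 1}$, $C\in\mathbb R^{1\times n_x}$ be a single-input single-output system $x_{k+1}=Ax_k+Bu_k$, $y_k=Cx_k$ with spectral radius $\rho(A)<1$, $(A,B)$ controllable and $(A,C)$ observable. Let $g_i=CA^iB$ ($i\ge 0$) be its Markov parameters, let $\det(zI-A)=z^{n_x}+a_1z^{n_x-1}+\dots+a_{n_x}$ and $\boldsymbol a=[a_{n_x},\dots,a_1]$. Let the number $n=n(N)$ of Markov parameters used with $N$ samples satisfy, as $N\to\infty$: (1) $n(N)\to\infty$; (2) $n(N)^{4+\delta}/N\to0$ for some $\delta>0$; (3) $\sqrt N\sum_{i\ge n(N)}|CA^iB|\to0$. Let $\boldsymbol g_n=[g_0,\dots,g_{n-1}]$ and let $\hat{\boldsymbol g}_n=[\hat g_0,\dots,\hat g_{n-1}]$ be random vectors (one for each $N$) on a common probability space with $\|\hat{\boldsymbol g}_n-\boldsymbol g_n\|_2\to0$ as $N\to\infty$ with probability one. Let $P_g=P_g(N)$ be symmetric $n(N)\times n(N)$ matrices (for example the asymptotic covariances of $\sqrt N(\hat{\boldsymbol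 g}_n-\boldsymbol g_n)$) that are uniformly positive definite, i.e. $P_g(N)\succeq cI$ for all $N$ with one constant $c>0$, and whose $k$-th diagonal entry is, for each fixed $k$, bounded in $N$. Let $\hat{\mathcal H}=(\hat g_{i+j})_{0\le i\le n_x,\;0\le j\le n-n_x-1}$, let $\hat{\mathcal H}^+$ be its first $n_x$ rows, $\hat{\mathcal H}^-$ its last row and $\hat\sigma_{n_x+1}$ its $(n_x+1)$-st (smallest) singular value. Let $\mathcal T(\boldsymbol a)\in\mathbb R^{n\times(n-n_x)}$ be the banded Toeplitz matrix whose $j$-th column is $[a_{n_x},\dots,a_1,1]^\top$ shifted down by $j-1$ places and padded with zeros, and let $W=(\mathcal T(\boldsymbol a)^\top P_g\mathcal T(\boldsymbol a))^{-1}$. Put $$\hat{\boldsymbol a}_{\rm ols}^\top=-\big(\hat{\mathcal H}^+(\hat{\mathcal H}^+)^\top\big)^{-1}\hat{\mathcal H}^+(\hat{\mathcal H}^-)^\top,\qquad \hat{\boldsymbol a}_{\rm tls}^\top=-\big(\hat{\mathcal H}^+(\hat{\mathcal H}^+)^\top-\hat\sigma_{n_x+1}^2I\big)^{-1}\hat{\mathcal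 H}^+(\hat{\mathcal H}^-)^\top,$$ $$\hat{\boldsymbol a}_{\rm wls}=-\hat{\mathcal H}^-W(\hat{\mathcal H}^+)^\top\big(\hat{\mathcal H}^+W(\hat{\mathcal H}^+)^\top\big)^{-1}.$$ Then, with probability one, for all sufficiently large $N$ these vectors are the unique solutions of, respectively: the ordinary least-squares problem of minimizing $\|\boldsymbol b\hat{\mathcal H}^++\hat{\mathcal H}^-\|$ over $\boldsymbol b$; the total least-squares problem of minimizing $\|\Delta\|_F$ over all $\Delta$ for which some $\boldsymbol b$ satisfies $[\boldsymbol b\ \ 1](\hat{\mathcal H}+\Delta)=0$ (a solution being any $\boldsymbol b$ that satisfies this equation for a minimizing $\Delta$); and the weighted least-squares problem of minimizing $rWr^\top$ with $r=\boldsymbol b\hat{\mathcal H}^++\hat{\mathcal H}^-$. Moreover, all three are strongly consistent: $\hat{\boldsymbol a}_{\rm ols}\to\boldsymbol a$, $\hat{\boldsymbol a}_{\rm tls}\to\boldsymbol a$ and $\hat{\boldsymbol a}_{\rm wls}\to\boldsymbol a$ as $N\to\infty$, with probability one. -/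

import Mathlib

open Filter Topology MeasureTheory Matrix
open scoped ENNReal

namespace Realization

noncomputable section

/-- The `i`-th Markov parameter `g_i = C A^i B` of the single-input single-output system
`x_{k+1} = A x_k + B u_k`, `y_k = C x_k`. -/
def markov {nx : ℕ} (A : Matrix (Fin nx) (Fin nx) ℝ) (B C : Fin nx → ℝ) (i : ℕ) : ℝ :=
  C ⬝ᵥ ((A ^ i) *ᵥ B)

/-- The vector of the first `n` Markov parameters `g_0, …, g_{n-1}`. -/
def markovVec {nx : ℕ} (A : Matrix (Fin nx) (Fin nx) ℝ) (B C : Fin nx → ℝ) (n : ℕ) :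
    Fin n → ℝ :=
  fun i => markov A B C i

/-- The controllability matrix `[B, AB, …, A^{nx-1} B]`. -/
def ctrbMatrix {nx : ℕ} (A : Matrix (Fin nx) (Fin nx) ℝ) (B : Fin nx → ℝ) :
    Matrix (Fin nx) (Fin nx) ℝ :=
  Matrix.of fun i j => ((A ^ (j : ℕ)) *ᵥ B) i

/-- The observability matrix with rows `C, CA, …, C A^{nx-1}`. -/
def obsvMatrix {nx : ℕ} (A : Matrix (Fin nx) (Fin nx) ℝ) (C : Fin nx → ℝ) :
    Matrix (Fin nx) (Fin nx) ℝ :=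
  Matrix.of fun i j => (C ᵥ* (A ^ (i : ℕ))) j

/-- Stability (all complex eigenvalues of `A` have modulus less than one) and minimality
(controllability and observability). -/
structure IsStableMinimal {nx : ℕ} (A : Matrix (Fin nx) (Fin nx) ℝ) (B C : Fin nx → ℝ) :
    Prop where
  stable : spectralRadius ℂ (A.map (algebraMap ℝ ℂ)) < 1
  controllable : (ctrbMatrix A B).rank = nx
  observable : (obsvMatrix A C).rank = nx

/-- The growth conditions on the number `n N` of Markov parameters as a function of the
sample size `N`. In the third one the sum is over the Markov parameters `C A^i B`, `i ≥ n N`,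
that are left out. -/
structure OrderGrowth {nx : ℕ} (A : Matrix (Fin nx) (Fin nx) ℝ) (B C : Fin nx → ℝ)
    (n : ℕ → ℕ) : Prop where
  tendsto_atTop : Tendsto n atTop atTop
  not_too_fast : ∃ δ : ℝ, 0 < δ ∧
    Tendsto (fun N : ℕ => (n N : ℝ) ^ (4 + δ) / (N : ℝ)) atTop (𝓝 0)
  tail : Tendsto (fun N : ℕ => Real.sqrt (N : ℝ) * ∑' k : ℕ, |markov A B C (n N + k)|)
    atTop (𝓝 0)

/-- The coefficient vector `a = [a_{nx}, …, a_1]` of the characteristic polynomial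
`X^nx + a_1 X^{nx-1} + ⋯ + a_{nx}` of `A`. -/
def charCoeffs {nx : ℕ} (A : Matrix (Fin nx) (Fin nx) ℝ) : Fin nx → ℝ :=
  fun i => A.charpoly.coeff i

/-- The vector `[b, 1]`. -/
def augment {nx : ℕ} (b : Fin nx → ℝ) : Fin (nx + 1) → ℝ :=
  Fin.snoc b 1

/-- The Hankel matrix with `nx + 1` rows and `p + 1 = n - nx` columns built from
`g_0, …, g_{n-1}`. -/
def hankel (nx : ℕ) {n : ℕ} (g : Fin n → ℝ) : Matrix (Fin (nx + 1)) (Fin (n - nx)) ℝ :=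
  Matrix.of fun i j => g ⟨(i : ℕ) + (j : ℕ), by omega⟩

/-- The first `nx` rows of the Hankel matrix. -/
def hankelUp (nx : ℕ) {n : ℕ} (g : Fin n → ℝ) : Matrix (Fin nx) (Fin (n - nx)) ℝ :=
  (hankel nx g).submatrix Fin.castSucc id

/-- The last row of the Hankel matrix. -/
def hankelLast (nx : ℕ) {n : ℕ} (g : Fin n → ℝ) : Fin (n - nx) → ℝ :=
  hankel nx g (Fin.last nx)

/-! ### Ordinary least squares -/

/-- The OLS estimate `âᵀ = -(H⁺ H⁺ᵀ)⁻¹ H⁺ (H⁻)ᵀ`. -/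
def olsEstimate (nx : ℕ) {n : ℕ} (g : Fin n → ℝ) : Fin nx → ℝ :=
  -((hankelUp nx g * (hankelUp nx g)ᵀ)⁻¹ *ᵥ (hankelUp nx g *ᵥ hankelLast nx g))

/-- `b` minimizes the Euclidean norm of the residual `b H⁺ + H⁻`. -/
def IsOLSSolution (nx : ℕ) {n : ℕ} (g : Fin n → ℝ) (b : Fin nx → ℝ) : Prop :=
  ∀ b' : Fin nx → ℝ,
    ‖WithLp.toLp 2 (b ᵥ* hankelUp nx g + hankelLast nx g)‖ ≤
      ‖WithLp.toLp 2 (b' ᵥ* hankelUp nx g + hankelLast nx g)‖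

/-! ### Total least squares -/

/-- The smallest (that is, the `(nx+1)`-st) singular value of the Hankel matrix `H`, read off
from `Hᵀ`, which has the same singular values (Mathlib indexes them from zero, in decreasing
order). -/
def sigmaMin (nx : ℕ) {n : ℕ} (g : Fin n → ℝ) : ℝ :=
  (Matrix.toEuclideanLin (hankel nx g)ᵀ).singularValues nx

/-- The TLS estimate `âᵀ = -(H⁺ H⁺ᵀ - σ² I)⁻¹ H⁺ (H⁻)ᵀ`, with `σ` the smallest singular value
of `H`. -/
def tlsEstimate (nx : ℕ) {n : ℕ} (g : Fin n → ℝ) : Fin nx → ℝ :=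
  -((hankelUp nx g * (hankelUp nx g)ᵀ - (sigmaMin nx g) ^ 2 • (1 : Matrix (Fin nx) (Fin nx) ℝ))⁻¹
      *ᵥ (hankelUp nx g *ᵥ hankelLast nx g))

/-- The Frobenius norm. -/
def frobNorm {m k : ℕ} (M : Matrix (Fin m) (Fin k) ℝ) : ℝ :=
  Real.sqrt (∑ i, ∑ j, (M i j) ^ 2)

/-- `b` is a TLS solution: it annihilates, `[b, 1] (H + Δ) = 0`, a corrected matrix whose
correction `Δ` has the least Frobenius norm among all `Δ'` for which the equation
`[b', 1] (H + Δ') = 0` is solvable in `b'`. -/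
def IsTLSSolution (nx : ℕ) {n : ℕ} (g : Fin n → ℝ) (b : Fin nx → ℝ) : Prop :=
  ∃ Δ : Matrix (Fin (nx + 1)) (Fin (n - nx)) ℝ,
    augment b ᵥ* (hankel nx g + Δ) = 0 ∧
      ∀ Δ' : Matrix (Fin (nx + 1)) (Fin (n - nx)) ℝ,
        (∃ b' : Fin nx → ℝ, augment b' ᵥ* (hankel nx g + Δ') = 0) → frobNorm Δ ≤ frobNorm Δ'

/-! ### Weighted least squares -/

/-- The `n × (n - nx)` banded Toeplitz matrix whose `j`-th column is `[b, 1]ᵀ` shifted down by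
`j` places. -/
def toeplitz {nx : ℕ} (n : ℕ) (b : Fin nx → ℝ) : Matrix (Fin n) (Fin (n - nx)) ℝ :=
  Matrix.of fun k j =>
    if h : (j : ℕ) ≤ (k : ℕ) ∧ (k : ℕ) - (j : ℕ) < nx + 1 then
      augment b ⟨(k : ℕ) - (j : ℕ), h.2⟩ else 0

/-- The weighting matrix `W(b) = (T(b)ᵀ P T(b))⁻¹`. -/
def weight {nx n : ℕ} (P : Matrix (Fin n) (Fin n) ℝ) (b : Fin nx → ℝ) :
    Matrix (Fin (n - nx)) (Fin (n - nx)) ℝ :=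
  ((toeplitz n b)ᵀ * P * toeplitz n b)⁻¹

/-- The WLS estimate `â = -H⁻ W H⁺ᵀ (H⁺ W H⁺ᵀ)⁻¹` for a weighting matrix `W`. -/
def wlsEstimate (nx : ℕ) {n : ℕ} (W : Matrix (Fin (n - nx)) (Fin (n - nx)) ℝ)
    (g : Fin n → ℝ) : Fin nx → ℝ :=
  -((hankelLast nx g ᵥ* (W * (hankelUp nx g)ᵀ)) ᵥ*
      (hankelUp nx g * W * (hankelUp nx g)ᵀ)⁻¹)

/-- `b` minimizes the weighted sum of squares `r W rᵀ` of the residual `r = b H⁺ + H⁻`. -/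
def IsWLSSolution (nx : ℕ) {n : ℕ} (W : Matrix (Fin (n - nx)) (Fin (n - nx)) ℝ)
    (g : Fin n → ℝ) (b : Fin nx → ℝ) : Prop :=
  ∀ b' : Fin nx → ℝ,
    (b ᵥ* hankelUp nx g + hankelLast nx g) ⬝ᵥ
        (W *ᵥ (b ᵥ* hankelUp nx g + hankelLast nx g)) ≤
      (b' ᵥ* hankelUp nx g + hankelLast nx g) ⬝ᵥ
        (W *ᵥ (b' ᵥ* hankelUp nx g + hankelLast nx g))

/-- Regularity of the covariance matrices `P N` (of size `n N`) that define the weighting: they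
are symmetric and positive definite uniformly in `N`, and the entry of each fixed place on the
diagonal stays bounded. -/
structure RegularCovariance (n : ℕ → ℕ) (P : ∀ N : ℕ, Matrix (Fin (n N)) (Fin (n N)) ℝ) :
    Prop where
  uniformly_posDef : ∃ c : ℝ, 0 < c ∧
    ∀ N, (P N - c • (1 : Matrix (Fin (n N)) (Fin (n N)) ℝ)).PosSemidef
  diag_bounded : ∀ k : ℕ, ∃ M : ℝ, ∀ N, ∀ hk : k < n N, P N ⟨k, hk⟩ ⟨k, hk⟩ ≤ M

end

end Realization

/-! Write `H` for the Hankel matrix of the estimates, `H⁺` and `H⁻` for its blocks, `a` for the true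
coefficients and `r = a H⁺ + H⁻`. For exact Markov parameters `[a, 1] H = 0` by Cayley–Hamilton, so
`r` is linear in the estimation error and `‖r‖²` is at most a constant, free of `n`, times the
squared error (`residual_le`). The leading `nx × nx` block of `H⁺` tends to observability times
controllability matrix, which is invertible, so `H⁺` is eventually bounded below uniformly
(`exists_pos_eventually_weighted_le`). A least-squares problem with such a bound has a unique
solution, whose distance from `a` is controlled by `r` (`wls_unique_and_bound`); OLS is the case `W
= 1`.

For WLS the bounds on `W` must not depend on its size (`exists_weight_bounds`). From above: `T(a)`
is multiplication by a polynomial with all roots in the open unit disc, hence bounded below in `ℓ²`,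
and so is `TᵀPT`. From below: Cauchy–Schwarz gives `v_i² ≤ (TᵀPT)_ii · vᵀWv`, and for `i < nx` this
diagonal entry sees only a fixed corner of `P`. That suffices, since the leading block of `H⁺`
occupies just those coordinates.

For TLS, `σ² ≤ ‖r‖²` tends to zero and falls below the bound for `H⁺H⁺ᵀ`. An eigenvector of `HHᵀ`
for `σ²` then has nonzero last entry, and normalizing that entry to one yields the estimate
(`tlsEstimate_eigenvector`, `isTLSSolution_iff`, `tlsEstimate_bound`). -/

namespace Realization

/-! ### Multiplication by a stable polynomial in `ℓ²` -/

open Polynomial in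
/-- A lower bound for multiplication by `X - z` in the `ℓ²` norm of coefficients; it is nontrivial
for `‖z‖ ≠ 1`. -/
lemma sum_norm_sq_coeff_X_sub_C_mul (z : ℂ) (p : ℂ[X]) (K : ℕ)
    (hp : ∀ i, K ≤ i → p.coeff i = 0) :
    (1 - ‖z‖) ^ 2 * ∑ i ∈ Finset.range K, ‖p.coeff i‖ ^ 2 ≤
      ∑ i ∈ Finset.range (K + 1), ‖((X - C z) * p).coeff i‖ ^ 2 := by
  have h0 : ((X - C z) * p).coeff 0 = -(z * p.coeff 0) := by
    simp [sub_mul, coeff_sub]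
  have h1 : ∀ i, ((X - C z) * p).coeff (i + 1) = p.coeff i - z * p.coeff (i + 1) := by
    intro i
    simp [sub_mul, coeff_sub, coeff_X_mul]
  -- Expand `(‖u‖ - ‖z‖‖v‖)²` and use `2‖u‖‖v‖ ≤ ‖u‖² + ‖v‖²`. Summed over adjacent coefficients,
  -- the weights combine to `(1 - ‖z‖) - ‖z‖(1 - ‖z‖) = (1 - ‖z‖)²`.
  have key : ∀ u v : ℂ, (1 - ‖z‖) * ‖u‖ ^ 2 - ‖z‖ * (1 - ‖z‖) * ‖v‖ ^ 2 ≤ ‖u - z * v‖ ^ 2 := by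
    intro u v
    have h2 : |‖u‖ - ‖z‖ * ‖v‖| ≤ ‖u - z * v‖ := by
      simpa using abs_norm_sub_norm_le u (z * v)
    have h3 : (‖u‖ - ‖z‖ * ‖v‖) ^ 2 ≤ ‖u - z * v‖ ^ 2 := by
      rw [← sq_abs]
      gcongr
    nlinarith [mul_nonneg (norm_nonneg z) (sq_nonneg (‖u‖ - ‖v‖))]
  have hshift : ∑ i ∈ Finset.range K, ‖p.coeff (i + 1)‖ ^ 2 + ‖p.coeff 0‖ ^ 2 =
      ∑ i ∈ Finset.range K, ‖p.coeff i‖ ^ 2 := by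
    rw [← Finset.sum_range_succ' (fun i => ‖p.coeff i‖ ^ 2), Finset.sum_range_succ, hp K le_rfl]
    simp
  rw [Finset.sum_range_succ', h0]
  simp only [h1]
  have hs := Finset.sum_le_sum fun i (_ : i ∈ Finset.range K) => key (p.coeff i) (p.coeff (i + 1))
  rw [Finset.sum_sub_distrib, ← Finset.mul_sum, ← Finset.mul_sum] at hs
  -- The lowest coefficient `-z p₀` supplies the `p₀` term that the shifted sum misses.
  have h4 := key 0 (p.coeff 0)
  simp only [zero_sub, norm_zero] at h4
  have h5 : ∑ i ∈ Finset.range K, ‖p.coeff (i + 1)‖ ^ 2 =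
      ∑ i ∈ Finset.range K, ‖p.coeff i‖ ^ 2 - ‖p.coeff 0‖ ^ 2 := by linarith
  rw [h5] at hs
  nlinarith

open Polynomial in
/-- A lower bound for multiplication by a monic split polynomial in the `ℓ²` norm of
coefficients. -/
lemma sum_norm_sq_coeff_prod_mul (s : Multiset ℂ) (p : ℂ[X]) (K : ℕ)
    (hp : ∀ i, K ≤ i → p.coeff i = 0) :
    ((s.map fun z => (1 - ‖z‖) ^ 2).prod) * ∑ i ∈ Finset.range K, ‖p.coeff i‖ ^ 2 ≤
      ∑ i ∈ Finset.range (K + s.card), ‖((s.map fun z => X - C z).prod * p).coeff i‖ ^ 2 := by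
  induction s using Multiset.induction_on generalizing p K with
  | empty => simp
  | cons z s ih =>
    simp only [Multiset.map_cons, Multiset.prod_cons, Multiset.card_cons]
    have h1 := sum_norm_sq_coeff_X_sub_C_mul z p K hp
    have h2 := ih ((X - C z) * p) (K + 1) (by
      intro i hi
      obtain ⟨j, rfl⟩ : ∃ j, i = j + 1 := ⟨i - 1, by omega⟩
      simp [sub_mul, coeff_sub, coeff_X_mul, hp j (by omega), hp (j + 1) (by omega)])
    have h3 : 0 ≤ (s.map fun z => (1 - ‖z‖) ^ 2).prod := by
      apply Multiset.prod_nonneg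
      intro a ha
      obtain ⟨w, -, rfl⟩ := Multiset.mem_map.1 ha
      positivity
    have h4 : (s.map fun z => X - C z).prod * ((X - C z) * p) =
        (X - C z) * (s.map fun z => X - C z).prod * p := by ring
    rw [h4, show K + 1 + s.card = K + (s.card + 1) by ring] at h2
    nlinarith [mul_le_mul_of_nonneg_left h1 h3]

lemma norm_lt_one_of_mem_roots_charpoly {nx : ℕ} (A : Matrix (Fin nx) (Fin nx) ℝ)
    (hA : spectralRadius ℂ (A.map (algebraMap ℝ ℂ)) < 1) {z : ℂ}
    (hz : z ∈ (A.map (algebraMap ℝ ℂ)).charpoly.roots) : ‖z‖ < 1 := by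
  have h1 : z ∈ spectrum ℂ (A.map (algebraMap ℝ ℂ)) := by
    rw [Matrix.mem_spectrum_iff_isRoot_charpoly]
    exact Polynomial.isRoot_of_mem_roots hz
  have h2 : (‖z‖₊ : ℝ≥0∞) ≤ spectralRadius ℂ (A.map (algebraMap ℝ ℂ)) :=
    le_iSup₂ (f := fun k (_ : k ∈ spectrum ℂ (A.map (algebraMap ℝ ℂ))) => (‖k‖₊ : ℝ≥0∞)) z h1
  have h3 := h2.trans_lt hA
  exact_mod_cast h3

open Polynomial in
/-- Multiplication by the characteristic polynomial of a Schur stable matrix is bounded below in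
the `ℓ²` norm of coefficients. -/
lemma exists_pos_mul_sum_sq_coeff_le {nx : ℕ} (A : Matrix (Fin nx) (Fin nx) ℝ)
    (hA : spectralRadius ℂ (A.map (algebraMap ℝ ℂ)) < 1) :
    ∃ c : ℝ, 0 < c ∧ ∀ (p : ℝ[X]) (K : ℕ), (∀ i, K ≤ i → p.coeff i = 0) →
      c * ∑ i ∈ Finset.range K, (p.coeff i) ^ 2 ≤
        ∑ i ∈ Finset.range (K + nx), ((A.charpoly * p).coeff i) ^ 2 := by
  set q := (A.map (algebraMap ℝ ℂ)).charpoly with hq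
  have hroot : ∀ z ∈ q.roots, ‖z‖ < 1 := fun z hz => norm_lt_one_of_mem_roots_charpoly A hA hz
  have hsplit : q.Splits := IsAlgClosed.splits q
  have hmonic : q.Monic := Matrix.charpoly_monic _
  have hcard : q.roots.card = nx := by
    rw [← hsplit.natDegree_eq_card_roots, hq, Matrix.charpoly_natDegree_eq_dim, Fintype.card_fin]
  have hprod : (q.roots.map fun z => X - C z).prod = A.charpoly.map (algebraMap ℝ ℂ) := by
    rw [← hsplit.eq_prod_roots_of_monic hmonic, hq, Matrix.charpoly_map]
  -- The constant depends on the roots alone, not on the length `K`; it is positive because no root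
  -- has modulus one.
  refine ⟨(q.roots.map fun z => (1 - ‖z‖) ^ 2).prod, ?_, fun p K hp => ?_⟩
  · apply Multiset.prod_pos
    intro a ha
    obtain ⟨w, hw, rfl⟩ := Multiset.mem_map.1 ha
    have := hroot w hw
    exact pow_pos (by linarith) 2
  · have h := sum_norm_sq_coeff_prod_mul q.roots
      (p.map (algebraMap ℝ ℂ)) K (fun i hi => by simp [hp i hi])
    rw [hprod, hcard, ← Polynomial.map_mul] at h
    simpa [-Polynomial.map_mul, Polynomial.coeff_map] using h

lemma augment_charCoeffs {nx : ℕ} (A : Matrix (Fin nx) (Fin nx) ℝ) (i : Fin (nx + 1)) :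
    augment (charCoeffs A) i = A.charpoly.coeff i := by
  induction i using Fin.lastCases with
  | last =>
    have h := Matrix.charpoly_monic A
    rw [Polynomial.Monic, Polynomial.leadingCoeff, Matrix.charpoly_natDegree_eq_dim,
      Fintype.card_fin] at h
    simp [augment, h]
  | cast i => simp [augment, charCoeffs]

lemma toeplitz_charCoeffs {nx : ℕ} (A : Matrix (Fin nx) (Fin nx) ℝ) (n : ℕ) (k : Fin n)
    (j : Fin (n - nx)) : toeplitz n (charCoeffs A) k j =
      if (j : ℕ) ≤ k then A.charpoly.coeff (k - j) else 0 := by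
  simp only [toeplitz, Matrix.of_apply]
  by_cases h1 : (j : ℕ) ≤ k
  · by_cases h2 : (k : ℕ) - j < nx + 1
    · rw [dif_pos ⟨h1, h2⟩, if_pos h1, augment_charCoeffs]
    · rw [dif_neg (fun h => h2 h.2), if_pos h1, Polynomial.coeff_eq_zero_of_natDegree_lt]
      rw [Matrix.charpoly_natDegree_eq_dim, Fintype.card_fin]
      omega
  · rw [dif_neg (fun h => h1 h.1), if_neg h1]

/-- The banded Toeplitz matrices of a Schur stable characteristic polynomial are bounded below
uniformly in their size. -/
lemma exists_pos_mul_le_toeplitz {nx : ℕ} (A : Matrix (Fin nx) (Fin nx) ℝ)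
    (hA : spectralRadius ℂ (A.map (algebraMap ℝ ℂ)) < 1) :
    ∃ c : ℝ, 0 < c ∧ ∀ n : ℕ, nx ≤ n → ∀ x : Fin (n - nx) → ℝ,
      c * (x ⬝ᵥ x) ≤ (toeplitz n (charCoeffs A) *ᵥ x) ⬝ᵥ (toeplitz n (charCoeffs A) *ᵥ x) := by
  obtain ⟨c, hc, h⟩ := exists_pos_mul_sum_sq_coeff_le A hA
  refine ⟨c, hc, fun n hn x => ?_⟩
  -- The vector `x` becomes a polynomial `p`, and `T x` lists the coefficients of `A.charpoly * p`.
  set p : Polynomial ℝ := ∑ j : Fin (n - nx), Polynomial.C (x j) * Polynomial.X ^ (j : ℕ) with hp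
  have hcoeff : ∀ i : Fin (n - nx), p.coeff i = x i := by
    intro i
    simp [hp, Polynomial.finsetSum_coeff, Polynomial.coeff_C_mul, Polynomial.coeff_X_pow,
      ← Fin.ext_iff]
  have hzero : ∀ i, n - nx ≤ i → p.coeff i = 0 := by
    intro i hi
    rw [hp, Polynomial.finsetSum_coeff]
    refine Finset.sum_eq_zero fun j _ => ?_
    rw [Polynomial.coeff_C_mul, Polynomial.coeff_X_pow, if_neg (by omega), mul_zero]
  have hT : ∀ k : Fin n, (toeplitz n (charCoeffs A) *ᵥ x) k = (A.charpoly * p).coeff k := by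
    intro k
    rw [hp, Finset.mul_sum, Polynomial.finsetSum_coeff, Matrix.mulVec, dotProduct]
    refine Finset.sum_congr rfl fun j _ => ?_
    rw [toeplitz_charCoeffs, ← mul_assoc, mul_comm A.charpoly, mul_assoc, Polynomial.coeff_C_mul,
      Polynomial.coeff_mul_X_pow', mul_comm]
  have h1 := h p (n - nx) hzero
  rw [Nat.sub_add_cancel hn, Finset.sum_range, Finset.sum_range] at h1
  simp only [dotProduct, hT]
  simpa only [hcoeff, sq] using h1

/-! ### Quadratic forms and inverses of positive matrices -/

lemma sq_dotProduct_le {ι : Type*} [Fintype ι] (u v : ι → ℝ) :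
    (u ⬝ᵥ v) ^ 2 ≤ (u ⬝ᵥ u) * (v ⬝ᵥ v) := by
  simpa only [dotProduct, sq] using Finset.sum_mul_sq_le_sq_mul_sq Finset.univ u v

lemma dotProduct_self_nonneg {ι : Type*} [Fintype ι] (u : ι → ℝ) : 0 ≤ u ⬝ᵥ u :=
  Finset.sum_nonneg fun i _ => mul_self_nonneg (u i)

lemma sq_apply_le_dotProduct_self {ι : Type*} [Fintype ι] (u : ι → ℝ) (i : ι) :
    u i ^ 2 ≤ u ⬝ᵥ u := by
  rw [sq]
  exact Finset.single_le_sum (f := fun i => u i * u i) (fun i _ => mul_self_nonneg (u i))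
    (Finset.mem_univ i)

/-- Symmetry of the bilinear form of a real symmetric matrix. -/
lemma dotProduct_mulVec_comm_of_isSymm {ι : Type*} [Fintype ι] {S : Matrix ι ι ℝ} (hS : Sᵀ = S)
    (u v : ι → ℝ) : u ⬝ᵥ (S *ᵥ v) = v ⬝ᵥ (S *ᵥ u) := by
  rw [Matrix.dotProduct_mulVec, ← Matrix.mulVec_transpose, hS, dotProduct_comm]

/-- The Cauchy–Schwarz inequality for a positive semidefinite matrix. -/
lemma sq_dotProduct_mulVec_le {ι : Type*} [Fintype ι] {S : Matrix ι ι ℝ} (hS : Sᵀ = S)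
    (hpos : ∀ x, 0 ≤ x ⬝ᵥ (S *ᵥ x)) (u v : ι → ℝ) :
    (u ⬝ᵥ (S *ᵥ v)) ^ 2 ≤ (u ⬝ᵥ (S *ᵥ u)) * (v ⬝ᵥ (S *ᵥ v)) := by
  have h : ∀ t : ℝ, 0 ≤ (v ⬝ᵥ (S *ᵥ v)) * (t * t) + (2 * (u ⬝ᵥ (S *ᵥ v))) * t +
      u ⬝ᵥ (S *ᵥ u) := by
    intro t
    have h1 := hpos (u + t • v)
    simp only [Matrix.mulVec_add, Matrix.mulVec_smul, dotProduct_add, add_dotProduct,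
      dotProduct_smul, smul_dotProduct, smul_eq_mul] at h1
    rw [dotProduct_mulVec_comm_of_isSymm hS v u] at h1
    linarith
  have h2 := discrim_le_zero h
  rw [discrim] at h2
  linarith

lemma abs_apply_le_of_diag_le {ι : Type*} [Fintype ι] [DecidableEq ι] {S : Matrix ι ι ℝ}
    (hS : Sᵀ = S) (hpos : ∀ x, 0 ≤ x ⬝ᵥ (S *ᵥ x)) {M : ℝ} {i j : ι} (hi : S i i ≤ M)
    (hj : S j j ≤ M) : |S i j| ≤ M := by
  have h := sq_dotProduct_mulVec_le hS hpos (Pi.single i 1) (Pi.single j 1)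
  have hi0 := hpos (Pi.single i 1)
  have hj0 := hpos (Pi.single j 1)
  simp only [Matrix.mulVec_single_one, single_one_dotProduct, Matrix.col_apply] at h hi0 hj0
  refine abs_le_of_sq_le_sq ?_ (hi0.trans hi)
  calc S i j ^ 2 ≤ S i i * S j j := h
    _ ≤ M * M := mul_le_mul hi hj hj0 (hi0.trans hi)
    _ = M ^ 2 := (sq M).symm

/-- A quadratic form is bounded on a vector through the diagonal entries on its support. -/
lemma dotProduct_mulVec_le_of_diag_le {ι : Type*} [Fintype ι] [DecidableEq ι] {S : Matrix ι ι ℝ}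
    (hS : Sᵀ = S) (hpos : ∀ x, 0 ≤ x ⬝ᵥ (S *ᵥ x)) {M : ℝ} (t : ι → ℝ)
    (ht : ∀ i, t i ≠ 0 → S i i ≤ M) :
    t ⬝ᵥ (S *ᵥ t) ≤ M * (∑ i, |t i|) ^ 2 := by
  rw [sq, Finset.sum_mul_sum, Finset.mul_sum]
  simp only [dotProduct, Matrix.mulVec, Finset.mul_sum]
  refine Finset.sum_le_sum fun i _ => Finset.sum_le_sum fun j _ => ?_
  rcases eq_or_ne (t i) 0 with h | h
  · simp [h]
  rcases eq_or_ne (t j) 0 with h' | h'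
  · simp [h']
  calc t i * (S i j * t j) ≤ |t i * (S i j * t j)| := le_abs_self _
    _ = |S i j| * (|t i| * |t j|) := by rw [abs_mul, abs_mul]; ring
    _ ≤ M * (|t i| * |t j|) := by
      gcongr
      exact abs_apply_le_of_diag_le hS hpos (ht i h) (ht j h')

lemma isUnit_det_of_forall_mul_le {ι : Type*} [Fintype ι] [DecidableEq ι] {S : Matrix ι ι ℝ}
    {c : ℝ} (hc : 0 < c) (hpos : ∀ x, c * (x ⬝ᵥ x) ≤ x ⬝ᵥ (S *ᵥ x)) : IsUnit S.det := by
  rw [← Matrix.isUnit_iff_isUnit_det, ← Matrix.mulVec_injective_iff_isUnit]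
  refine (injective_iff_map_eq_zero (Matrix.mulVecLin S)).2 fun x hx => ?_
  have h1 := hpos x
  rw [show S *ᵥ x = 0 from hx, dotProduct_zero] at h1
  refine dotProduct_self_eq_zero.1 (le_antisymm ?_ (dotProduct_self_nonneg x))
  nlinarith [dotProduct_self_nonneg x]

/-- Bounds for the quadratic form of the inverse of a uniformly positive definite matrix. -/
lemma inv_quadraticForm_bounds {ι : Type*} [Fintype ι] [DecidableEq ι] {S : Matrix ι ι ℝ}
    (hS : Sᵀ = S) {c : ℝ} (hc : 0 < c) (hpos : ∀ x, c * (x ⬝ᵥ x) ≤ x ⬝ᵥ (S *ᵥ x)) :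
    (S⁻¹)ᵀ = S⁻¹ ∧ (∀ v, 0 ≤ v ⬝ᵥ (S⁻¹ *ᵥ v)) ∧ (∀ v, v ⬝ᵥ (S⁻¹ *ᵥ v) ≤ c⁻¹ * (v ⬝ᵥ v)) ∧
      ∀ v i, v i ^ 2 ≤ S i i * (v ⬝ᵥ (S⁻¹ *ᵥ v)) := by
  have hpos' : ∀ x, 0 ≤ x ⬝ᵥ (S *ᵥ x) := fun x =>
    (mul_nonneg hc.le (dotProduct_self_nonneg x)).trans (hpos x)
  have hdet : IsUnit S.det := isUnit_det_of_forall_mul_le hc hpos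
  have hinv : ∀ v, S *ᵥ (S⁻¹ *ᵥ v) = v := fun v => by
    rw [Matrix.mulVec_mulVec, Matrix.mul_nonsing_inv S hdet, Matrix.one_mulVec]
  have hQ : ∀ v, v ⬝ᵥ (S⁻¹ *ᵥ v) = (S⁻¹ *ᵥ v) ⬝ᵥ (S *ᵥ (S⁻¹ *ᵥ v)) := fun v => by
    rw [hinv, dotProduct_comm]
  refine ⟨by rw [Matrix.transpose_nonsing_inv, hS], fun v => hQ v ▸ hpos' _, fun v => ?_,
    fun v i => ?_⟩
  -- With `y = S⁻¹ v` and `q = v ⬝ᵥ y`: `c (y ⬝ᵥ y) ≤ q` and `q² ≤ (v ⬝ᵥ v)(y ⬝ᵥ y)`, so `c q² ≤ (v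
  -- ⬝ᵥ v) q`; then cancel `q` unless it is zero.
  · have h1 := hpos (S⁻¹ *ᵥ v)
    rw [← hQ] at h1
    have h2 := sq_dotProduct_le v (S⁻¹ *ᵥ v)
    have h3 := hpos' (S⁻¹ *ᵥ v)
    rw [← hQ] at h3
    rw [← div_eq_inv_mul, le_div_iff₀ hc]
    rcases h3.eq_or_lt with h4 | h4
    · rw [← h4, zero_mul]
      exact dotProduct_self_nonneg v
    · refine le_of_mul_le_mul_right ?_ h4
      nlinarith [dotProduct_self_nonneg v]
  -- Cauchy–Schwarz in the form of `S` for `e_i` and `S⁻¹ v`: only the diagonal entry `S i i`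
  -- enters, so no upper bound on `S` is needed.
  · have h := sq_dotProduct_mulVec_le hS hpos' (Pi.single i 1) (S⁻¹ *ᵥ v)
    rw [← hQ, hinv] at h
    simpa only [Matrix.mulVec_single_one, single_one_dotProduct, Matrix.col_apply] using h

/-! ### Size-independent bounds on the weights -/

lemma sum_abs_toeplitz_le {nx : ℕ} (n : ℕ) (b : Fin nx → ℝ) (j : Fin (n - nx)) :
    ∑ k, |toeplitz n b k j| ≤ ∑ i, |augment b i| := by
  have hsum : ∀ k : Fin n, |toeplitz n b k j| =
      ∑ i : Fin (nx + 1), if (k : ℕ) = j + i then |augment b i| else 0 := by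
    intro k
    simp only [toeplitz, Matrix.of_apply]
    split_ifs with h
    · rw [Finset.sum_eq_single (⟨k - j, h.2⟩ : Fin (nx + 1))]
      · rw [if_pos]
        simp only
        omega
      · intro i _ hi
        rw [if_neg]
        intro h'
        exact hi (Fin.ext (by simp only; omega))
      · simp
    · rw [abs_zero, eq_comm]
      refine Finset.sum_eq_zero fun i _ => if_neg fun h' => h ⟨by omega, by omega⟩
  simp only [hsum]
  rw [Finset.sum_comm]
  refine Finset.sum_le_sum fun i _ => ?_
  have hlt : (j : ℕ) + i < n := by omega
  rw [Finset.sum_eq_single (⟨j + i, hlt⟩ : Fin n)]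
  · simp
  · intro k _ hk
    rw [if_neg]
    exact fun h => hk (Fin.ext h)
  · simp

/-- The weighting matrices of weighted least squares are bounded above uniformly in their size, and
they control each of the first `nx` coordinates. -/
lemma exists_weight_bounds {nx : ℕ} (A : Matrix (Fin nx) (Fin nx) ℝ)
    (hA : spectralRadius ℂ (A.map (algebraMap ℝ ℂ)) < 1) (n : ℕ → ℕ)
    (P : ∀ N : ℕ, Matrix (Fin (n N)) (Fin (n N)) ℝ) (hP : RegularCovariance n P) :
    ∃ K κ : ℝ, 0 ≤ K ∧ 0 < κ ∧ ∀ N, nx ≤ n N →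
      (weight (P N) (charCoeffs A))ᵀ = weight (P N) (charCoeffs A) ∧
      (∀ v, 0 ≤ v ⬝ᵥ (weight (P N) (charCoeffs A) *ᵥ v)) ∧
      (∀ v, v ⬝ᵥ (weight (P N) (charCoeffs A) *ᵥ v) ≤ K * (v ⬝ᵥ v)) ∧
      ∀ (v : Fin (n N - nx) → ℝ) (i : Fin (n N - nx)), (i : ℕ) < nx →
        κ * v i ^ 2 ≤ v ⬝ᵥ (weight (P N) (charCoeffs A) *ᵥ v) := by
  obtain ⟨c, hc, hPc⟩ := hP.uniformly_posDef
  obtain ⟨d, hd, hT⟩ := exists_pos_mul_le_toeplitz A hA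
  choose M hM using hP.diag_bounded
  -- Columns `0, …, nx - 1` of the Toeplitz matrix are supported in rows below `2 * nx`, so finitely
  -- many of the diagonal bounds suffice. The `+ 1` in `L` only ensures positivity.
  set M' : ℝ := ∑ k ∈ Finset.range (2 * nx), |M k| with hM'
  set L : ℝ := M' * (∑ i, |augment (charCoeffs A) i|) ^ 2 + 1 with hL
  have hM'0 : 0 ≤ M' := Finset.sum_nonneg fun k _ => abs_nonneg _
  have hLpos : 0 < L := by positivity
  refine ⟨(c * d)⁻¹, L⁻¹, by positivity, by positivity, fun N hN => ?_⟩
  have hPsymm : (P N)ᵀ = P N := by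
    have h := (hPc N).isHermitian.eq
    rw [Matrix.conjTranspose_eq_transpose_of_trivial, Matrix.transpose_sub,
      Matrix.transpose_smul, Matrix.transpose_one] at h
    exact sub_left_injective h
  have hPlow : ∀ x, c * (x ⬝ᵥ x) ≤ x ⬝ᵥ (P N *ᵥ x) := by
    intro x
    have h := (hPc N).dotProduct_mulVec_nonneg x
    simp only [Matrix.sub_mulVec, Matrix.smul_mulVec, Matrix.one_mulVec, dotProduct_sub,
      dotProduct_smul, smul_eq_mul, star_trivial] at h
    linarith
  have hPpos : ∀ x, 0 ≤ x ⬝ᵥ (P N *ᵥ x) := fun x =>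
    (mul_nonneg hc.le (dotProduct_self_nonneg x)).trans (hPlow x)
  set T := toeplitz (n N) (charCoeffs A) with hTdef
  have hQ : ∀ x, x ⬝ᵥ ((Tᵀ * P N * T) *ᵥ x) = (T *ᵥ x) ⬝ᵥ (P N *ᵥ (T *ᵥ x)) := by
    intro x
    rw [← Matrix.mulVec_mulVec, ← Matrix.mulVec_mulVec, Matrix.dotProduct_mulVec,
      Matrix.vecMul_transpose]
  obtain ⟨h1, h2, h3, h4⟩ := inv_quadraticForm_bounds (S := Tᵀ * P N * T) (c := c * d)
    (by simp only [Matrix.transpose_mul, Matrix.transpose_transpose, hPsymm, Matrix.mul_assoc])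
    (by positivity) (fun x => by
      rw [hQ, mul_assoc]
      exact (mul_le_mul_of_nonneg_left (hT (n N) hN x) hc.le).trans (hPlow _))
  refine ⟨h1, h2, h3, fun v i hi => ?_⟩
  have hdiag : (Tᵀ * P N * T) i i ≤ L := by
    have h5 := hQ (Pi.single i 1)
    simp only [Matrix.mulVec_single_one, single_one_dotProduct, Matrix.col_apply] at h5
    rw [h5]
    have h6 : (T.col i) ⬝ᵥ (P N *ᵥ T.col i) ≤ M' * (∑ k, |T.col i k|) ^ 2 := by
      refine dotProduct_mulVec_le_of_diag_le hPsymm hPpos _ fun k hk => ?_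
      have hk' : (k : ℕ) < 2 * nx := by
        by_contra hcon
        refine hk ?_
        simp only [hTdef, Matrix.col_apply, toeplitz, Matrix.of_apply]
        rw [dif_neg]
        omega
      calc P N k k ≤ M k := hM k N k.2
        _ ≤ |M k| := le_abs_self _
        _ ≤ M' := Finset.single_le_sum (f := fun k => |M k|) (fun k _ => abs_nonneg _)
          (Finset.mem_range.2 hk')
    have h7 := sum_abs_toeplitz_le (n N) (charCoeffs A) i
    have h8 : (∑ k, |T.col i k|) ^ 2 ≤ (∑ i, |augment (charCoeffs A) i|) ^ 2 :=
      pow_le_pow_left₀ (Finset.sum_nonneg fun k _ => abs_nonneg _) h7 2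
    have h9 := mul_le_mul_of_nonneg_left h8 hM'0
    linarith
  rw [inv_mul_le_iff₀ hLpos]
  exact (h4 v i).trans (mul_le_mul_of_nonneg_right hdiag (h2 v))

/-! ### Weighted and ordinary least squares -/

/-- Orthogonal decomposition of the weighted sum of squares around the weighted least-squares
estimate. -/
lemma weightedSq_eq_add {nx n : ℕ} {W : Matrix (Fin (n - nx)) (Fin (n - nx)) ℝ} (hW : Wᵀ = W)
    (g : Fin n → ℝ) (hU : IsUnit (hankelUp nx g * W * (hankelUp nx g)ᵀ).det) (b : Fin nx → ℝ) :
    (b ᵥ* hankelUp nx g + hankelLast nx g) ⬝ᵥ (W *ᵥ (b ᵥ* hankelUp nx g + hankelLast nx g)) =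
      (wlsEstimate nx W g ᵥ* hankelUp nx g + hankelLast nx g) ⬝ᵥ
          (W *ᵥ (wlsEstimate nx W g ᵥ* hankelUp nx g + hankelLast nx g)) +
        ((b - wlsEstimate nx W g) ᵥ* hankelUp nx g) ⬝ᵥ
          (W *ᵥ ((b - wlsEstimate nx W g) ᵥ* hankelUp nx g)) := by
  set U := hankelUp nx g
  set h := hankelLast nx g
  set d := wlsEstimate nx W g with hd
  -- The normal equations: the optimal residual is `W`-orthogonal to the row space of `H⁺`, which
  -- kills the cross term below.
  have hnormal : (d ᵥ* U + h) ᵥ* (W * Uᵀ) = 0 := by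
    rw [Matrix.add_vecMul, Matrix.vecMul_vecMul, ← Matrix.mul_assoc, hd, wlsEstimate,
      Matrix.neg_vecMul, Matrix.vecMul_vecMul, Matrix.nonsing_inv_mul _ hU, Matrix.vecMul_one,
      neg_add_cancel]
  have hcross : (d ᵥ* U + h) ⬝ᵥ (W *ᵥ ((b - d) ᵥ* U)) = 0 := by
    rw [← Matrix.mulVec_transpose U (b - d), Matrix.mulVec_mulVec, Matrix.dotProduct_mulVec, hnormal,
      zero_dotProduct]
  have hb : b ᵥ* U + h = (d ᵥ* U + h) + (b - d) ᵥ* U := by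
    rw [Matrix.sub_vecMul]
    abel
  rw [hb, Matrix.mulVec_add, add_dotProduct, dotProduct_add, dotProduct_add,
    dotProduct_mulVec_comm_of_isSymm hW ((b - d) ᵥ* U), hcross]
  ring

/-- If the weighted quadratic form is bounded below on the row space of `H⁺`, the weighted
least-squares estimate is the unique weighted least-squares solution, and its error is bounded by
the residual. -/
lemma wls_unique_and_bound {nx n : ℕ} {W : Matrix (Fin (n - nx)) (Fin (n - nx)) ℝ} (hW : Wᵀ = W)
    (hpos : ∀ v, 0 ≤ v ⬝ᵥ (W *ᵥ v)) (g : Fin n → ℝ) {κ : ℝ} (hκ : 0 < κ)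
    (hlow : ∀ b : Fin nx → ℝ,
      κ * (b ⬝ᵥ b) ≤ (b ᵥ* hankelUp nx g) ⬝ᵥ (W *ᵥ (b ᵥ* hankelUp nx g))) :
    (∀ b, IsWLSSolution nx W g b ↔ b = wlsEstimate nx W g) ∧
      ∀ b : Fin nx → ℝ, κ * ((b - wlsEstimate nx W g) ⬝ᵥ (b - wlsEstimate nx W g)) ≤
        (b ᵥ* hankelUp nx g + hankelLast nx g) ⬝ᵥ
          (W *ᵥ (b ᵥ* hankelUp nx g + hankelLast nx g)) := by
  have hU : IsUnit (hankelUp nx g * W * (hankelUp nx g)ᵀ).det := by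
    refine isUnit_det_of_forall_mul_le hκ fun x => ?_
    rw [← Matrix.mulVec_mulVec, ← Matrix.mulVec_mulVec, Matrix.dotProduct_mulVec,
      Matrix.mulVec_transpose]
    exact hlow x
  refine ⟨fun b => ⟨fun h => ?_, ?_⟩, fun b => ?_⟩
  · have h1 := h (wlsEstimate nx W g)
    rw [weightedSq_eq_add hW g hU b] at h1
    have h2 := hlow (b - wlsEstimate nx W g)
    have h3 := dotProduct_self_nonneg (b - wlsEstimate nx W g)
    refine sub_eq_zero.1 (dotProduct_self_eq_zero.1 (le_antisymm ?_ h3))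
    nlinarith
  · rintro rfl b'
    rw [weightedSq_eq_add hW g hU b']
    exact le_add_of_nonneg_right (hpos _)
  · rw [weightedSq_eq_add hW g hU b]
    exact (hlow _).trans (le_add_of_nonneg_left (hpos _))

lemma olsEstimate_eq_wlsEstimate (nx : ℕ) {n : ℕ} (g : Fin n → ℝ) :
    olsEstimate nx g = wlsEstimate nx 1 g := by
  rw [olsEstimate, wlsEstimate, Matrix.one_mul, Matrix.mul_one, Matrix.vecMul_transpose,
    ← Matrix.mulVec_transpose, Matrix.transpose_nonsing_inv, Matrix.transpose_mul,
    Matrix.transpose_transpose]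

lemma norm_toLp_sq {ι : Type*} [Fintype ι] (v : ι → ℝ) : ‖WithLp.toLp 2 v‖ ^ 2 = v ⬝ᵥ v := by
  rw [EuclideanSpace.real_norm_sq_eq]
  simp [dotProduct, sq]

lemma isOLSSolution_iff_isWLSSolution (nx : ℕ) {n : ℕ} (g : Fin n → ℝ) (b : Fin nx → ℝ) :
    IsOLSSolution nx g b ↔ IsWLSSolution nx 1 g b := by
  refine forall_congr' fun b' => ?_
  rw [Matrix.one_mulVec, Matrix.one_mulVec, ← norm_toLp_sq, ← norm_toLp_sq,
    sq_le_sq₀ (norm_nonneg _) (norm_nonneg _)]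

/-! ### Smallest singular value and total least squares -/

lemma augment_dotProduct_self {nx : ℕ} (b : Fin nx → ℝ) :
    augment b ⬝ᵥ augment b = b ⬝ᵥ b + 1 := by
  simp [dotProduct, Fin.sum_univ_castSucc, augment]

lemma snoc_vecMul_hankel {nx n : ℕ} (g : Fin n → ℝ) (b : Fin nx → ℝ) (t : ℝ) :
    (Fin.snoc b t : Fin (nx + 1) → ℝ) ᵥ* hankel nx g =
      b ᵥ* hankelUp nx g + t • hankelLast nx g := by
  ext j
  simp [Matrix.vecMul, dotProduct, Fin.sum_univ_castSucc, hankelUp, hankelLast]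

lemma augment_vecMul_hankel {nx n : ℕ} (g : Fin n → ℝ) (b : Fin nx → ℝ) :
    augment b ᵥ* hankel nx g = b ᵥ* hankelUp nx g + hankelLast nx g := by
  rw [augment, snoc_vecMul_hankel, one_smul]

/-- The smallest singular value bounds the matrix from below. -/
lemma sq_sigmaMin_mul_le (nx : ℕ) {n : ℕ} (g : Fin n → ℝ) (x : Fin (nx + 1) → ℝ) :
    sigmaMin nx g ^ 2 * (x ⬝ᵥ x) ≤ (x ᵥ* hankel nx g) ⬝ᵥ (x ᵥ* hankel nx g) := by
  set T := Matrix.toEuclideanLin (hankel nx g)ᵀ with hT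
  have hfin : Module.finrank ℝ (EuclideanSpace ℝ (Fin (nx + 1))) = nx + 1 := by simp
  have hsymm := T.isSymmetric_adjoint_comp_self
  set e := hsymm.eigenvectorBasis hfin with he
  -- Since `Hᵀ` acts on a space of dimension `nx + 1`, index `nx` is the last in the decreasing list
  -- of eigenvalues of `HHᵀ`, even if `H` has fewer columns than rows.
  have hval : ∀ i, sigmaMin nx g ^ 2 ≤ hsymm.eigenvalues hfin i := by
    intro i
    rw [sigmaMin, LinearMap.sq_singularValues_of_lt _ hfin (Nat.lt_succ_self nx)]
    exact hsymm.eigenvalues_antitone hfin (Fin.le_last i)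
  set y : EuclideanSpace ℝ (Fin (nx + 1)) := WithLp.toLp 2 x with hy
  have h1 : x ⬝ᵥ x = ∑ i, (e.repr y i) ^ 2 := by
    rw [← norm_toLp_sq, ← hy, ← e.repr.norm_map y, EuclideanSpace.real_norm_sq_eq]
  have h2 : (x ᵥ* hankel nx g) ⬝ᵥ (x ᵥ* hankel nx g) =
      ∑ i, hsymm.eigenvalues hfin i * (e.repr y i) ^ 2 := by
    have h3 : WithLp.toLp 2 (x ᵥ* hankel nx g) = T y := by
      rw [hT, hy, Matrix.toEuclideanLin, Matrix.toLpLin_toLp, Matrix.toLin'_apply, Matrix.mulVec_transpose]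
    rw [← norm_toLp_sq, h3, ← real_inner_self_eq_norm_sq, ← LinearMap.adjoint_inner_right,
      ← e.repr.inner_map_map, PiLp.inner_apply]
    refine Finset.sum_congr rfl fun i _ => ?_
    have h4 := hsymm.eigenvectorBasis_apply_self_apply hfin y i
    rw [LinearMap.comp_apply] at h4
    rw [h4]
    simp only [← he, RCLike.inner_apply, conj_trivial, RCLike.ofReal_real_eq_id, id]
    ring
  rw [h1, h2, Finset.mul_sum]
  exact Finset.sum_le_sum fun i _ => mul_le_mul_of_nonneg_right (hval i) (sq_nonneg _)

/-- The square of the smallest singular value is an eigenvalue of `H Hᵀ`. -/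
lemma exists_eigenvector_sigmaMin (nx : ℕ) {n : ℕ} (g : Fin n → ℝ) :
    ∃ v : Fin (nx + 1) → ℝ, v ≠ 0 ∧
      hankel nx g *ᵥ (v ᵥ* hankel nx g) = sigmaMin nx g ^ 2 • v := by
  set T := Matrix.toEuclideanLin (hankel nx g)ᵀ with hT
  have hlt : nx < Module.finrank ℝ (EuclideanSpace ℝ (Fin (nx + 1))) := by simp
  obtain ⟨v, hv⟩ := (T.hasEigenvalue_adjoint_comp_self_sq_singularValues hlt).exists_hasEigenvector
  refine ⟨v.ofLp, fun h => hv.2 (by ext i; exact congrFun h i), ?_⟩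
  have h := hv.apply_eq_smul
  rw [hT, ← Matrix.toEuclideanLin_conjTranspose_eq_adjoint,
    Matrix.conjTranspose_eq_transpose_of_trivial, Matrix.transpose_transpose] at h
  have h' := congrArg WithLp.ofLp h
  simpa [Matrix.toEuclideanLin, Matrix.toLpLin_apply, Matrix.mulVec_transpose, sigmaMin] using h'

lemma vecMul_dotProduct_self_le {m k : ℕ} (x : Fin m → ℝ) (D : Matrix (Fin m) (Fin k) ℝ) :
    (x ᵥ* D) ⬝ᵥ (x ᵥ* D) ≤ (x ⬝ᵥ x) * ∑ i, ∑ j, D i j ^ 2 := by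
  rw [Finset.sum_comm, Finset.mul_sum]
  refine Finset.sum_le_sum fun j _ => ?_
  have h := sq_dotProduct_le x (fun i => D i j)
  simp only [dotProduct, Matrix.vecMul, ← sq] at h ⊢
  exact h

/-- The rank-one correction that makes `x` a left null vector. -/
lemma exists_correction {m k : ℕ} (H : Matrix (Fin m) (Fin k) ℝ) (x : Fin m → ℝ)
    (hx : 0 < x ⬝ᵥ x) : ∃ D : Matrix (Fin m) (Fin k) ℝ, x ᵥ* (H + D) = 0 ∧
      (x ⬝ᵥ x) * ∑ i, ∑ j, D i j ^ 2 = (x ᵥ* H) ⬝ᵥ (x ᵥ* H) := by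
  refine ⟨-(x ⬝ᵥ x)⁻¹ • Matrix.vecMulVec x (x ᵥ* H), ?_, ?_⟩
  · rw [Matrix.vecMul_add, Matrix.vecMul_smul, Matrix.vecMul_vecMulVec, smul_smul, neg_mul,
      inv_mul_cancel₀ hx.ne', neg_one_smul, add_neg_cancel]
  · simp only [Matrix.smul_apply, Matrix.vecMulVec_apply, smul_eq_mul, mul_pow, ← Finset.mul_sum,
      ← Finset.sum_mul]
    have h1 : ∀ {l : ℕ} (v : Fin l → ℝ), ∑ i, v i ^ 2 = v ⬝ᵥ v := fun v => by
      simp [dotProduct, sq]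
    rw [h1, h1]
    field_simp

lemma hankel_mulVec_castSucc {nx n : ℕ} (g : Fin n → ℝ) (w : Fin (n - nx) → ℝ) (i : Fin nx) :
    (hankel nx g *ᵥ w) i.castSucc = (hankelUp nx g *ᵥ w) i := rfl

section TotalLeastSquares

variable {nx n : ℕ} {g : Fin n → ℝ} {κ : ℝ}

lemma isUnit_det_gram_sub
    (hlow : ∀ b : Fin nx → ℝ, κ * (b ⬝ᵥ b) ≤ (b ᵥ* hankelUp nx g) ⬝ᵥ (b ᵥ* hankelUp nx g))
    (hσ : sigmaMin nx g ^ 2 < κ) :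
    IsUnit (hankelUp nx g * (hankelUp nx g)ᵀ -
      (sigmaMin nx g) ^ 2 • (1 : Matrix (Fin nx) (Fin nx) ℝ)).det := by
  refine isUnit_det_of_forall_mul_le (sub_pos.2 hσ) fun x => ?_
  have h := hlow x
  rw [Matrix.sub_mulVec, Matrix.smul_mulVec, Matrix.one_mulVec, dotProduct_sub, dotProduct_smul,
    ← Matrix.mulVec_mulVec, Matrix.dotProduct_mulVec, Matrix.mulVec_transpose, smul_eq_mul]
  linarith

lemma gram_sub_mulVec_tlsEstimate
    (hlow : ∀ b : Fin nx → ℝ, κ * (b ⬝ᵥ b) ≤ (b ᵥ* hankelUp nx g) ⬝ᵥ (b ᵥ* hankelUp nx g))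
    (hσ : sigmaMin nx g ^ 2 < κ) :
    hankelUp nx g *ᵥ (tlsEstimate nx g ᵥ* hankelUp nx g) - sigmaMin nx g ^ 2 • tlsEstimate nx g =
      -(hankelUp nx g *ᵥ hankelLast nx g) := by
  have h : (hankelUp nx g * (hankelUp nx g)ᵀ -
      (sigmaMin nx g) ^ 2 • (1 : Matrix (Fin nx) (Fin nx) ℝ)) *ᵥ tlsEstimate nx g =
      -(hankelUp nx g *ᵥ hankelLast nx g) := by
    rw [tlsEstimate, Matrix.mulVec_neg, Matrix.mulVec_mulVec,
      Matrix.mul_nonsing_inv _ (isUnit_det_gram_sub hlow hσ), Matrix.one_mulVec]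
  rwa [Matrix.sub_mulVec, Matrix.smul_mulVec, Matrix.one_mulVec, ← Matrix.mulVec_mulVec,
    Matrix.mulVec_transpose] at h

/-- The first `nx` rows of the eigenvector equation are the shifted normal equations that define the
estimate, and their matrix is invertible because `σ² < κ`. -/
lemma eq_tlsEstimate_of_eigenvector
    (hlow : ∀ b : Fin nx → ℝ, κ * (b ⬝ᵥ b) ≤ (b ᵥ* hankelUp nx g) ⬝ᵥ (b ᵥ* hankelUp nx g))
    (hσ : sigmaMin nx g ^ 2 < κ) {b : Fin nx → ℝ}
    (hb : hankel nx g *ᵥ (augment b ᵥ* hankel nx g) = sigmaMin nx g ^ 2 • augment b) :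
    b = tlsEstimate nx g := by
  have h1 : hankelUp nx g *ᵥ (b ᵥ* hankelUp nx g + hankelLast nx g) = sigmaMin nx g ^ 2 • b := by
    ext i
    have h := congrFun hb i.castSucc
    rw [hankel_mulVec_castSucc, augment_vecMul_hankel] at h
    simpa [augment] using h
  have h2 : (hankelUp nx g * (hankelUp nx g)ᵀ -
      (sigmaMin nx g) ^ 2 • (1 : Matrix (Fin nx) (Fin nx) ℝ)) *ᵥ b =
      -(hankelUp nx g *ᵥ hankelLast nx g) := by
    rw [Matrix.sub_mulVec, Matrix.smul_mulVec, Matrix.one_mulVec, ← Matrix.mulVec_mulVec,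
      Matrix.mulVec_transpose, ← h1, Matrix.mulVec_add]
    abel
  rw [tlsEstimate, ← Matrix.mulVec_neg, ← h2, Matrix.mulVec_mulVec,
    Matrix.nonsing_inv_mul _ (isUnit_det_gram_sub hlow hσ), Matrix.one_mulVec]

lemma tlsEstimate_eigenvector
    (hlow : ∀ b : Fin nx → ℝ, κ * (b ⬝ᵥ b) ≤ (b ᵥ* hankelUp nx g) ⬝ᵥ (b ᵥ* hankelUp nx g))
    (hσ : sigmaMin nx g ^ 2 < κ) :
    hankel nx g *ᵥ (augment (tlsEstimate nx g) ᵥ* hankel nx g) =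
      sigmaMin nx g ^ 2 • augment (tlsEstimate nx g) := by
  obtain ⟨v, hv0, hv⟩ := exists_eigenvector_sigmaMin nx g
  obtain ⟨b, t, rfl⟩ : ∃ (b : Fin nx → ℝ) (t : ℝ), v = Fin.snoc b t :=
    ⟨Fin.init v, v (Fin.last nx), (Fin.snoc_init_self v).symm⟩
  -- Were the last entry zero, `b` would be an eigenvector of `H⁺H⁺ᵀ` for `σ² < κ`, against the
  -- lower bound.
  have ht : t ≠ 0 := by
    rintro rfl
    have h1 : hankelUp nx g *ᵥ (b ᵥ* hankelUp nx g) = sigmaMin nx g ^ 2 • b := by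
      ext i
      have h := congrFun hv i.castSucc
      rw [hankel_mulVec_castSucc, snoc_vecMul_hankel, zero_smul, add_zero] at h
      simpa using h
    have h2 := hlow b
    rw [← Matrix.dotProduct_mulVec, h1, dotProduct_smul, smul_eq_mul] at h2
    have h3 : b = 0 := by
      refine dotProduct_self_eq_zero.1 (le_antisymm ?_ (dotProduct_self_nonneg b))
      nlinarith [dotProduct_self_nonneg b]
    subst h3
    refine hv0 (funext fun i => ?_)
    induction i using Fin.lastCases <;> simp
  have hscale : (Fin.snoc b t : Fin (nx + 1) → ℝ) = t • augment (t⁻¹ • b) := by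
    ext i
    induction i using Fin.lastCases <;> simp [augment, ht]
  have h4 : hankel nx g *ᵥ (augment (t⁻¹ • b) ᵥ* hankel nx g) =
      sigmaMin nx g ^ 2 • augment (t⁻¹ • b) := by
    rw [hscale, Matrix.smul_vecMul, Matrix.mulVec_smul, smul_comm] at hv
    exact smul_right_injective _ ht hv
  rw [← eq_tlsEstimate_of_eigenvector hlow hσ h4]
  exact h4

/-- If `H⁺` is bounded below by more than the smallest singular value of `H`, the total
least-squares estimate is the unique total least-squares solution. -/
lemma isTLSSolution_iff
    (hlow : ∀ b : Fin nx → ℝ, κ * (b ⬝ᵥ b) ≤ (b ᵥ* hankelUp nx g) ⬝ᵥ (b ᵥ* hankelUp nx g))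
    (hσ : sigmaMin nx g ^ 2 < κ) (b : Fin nx → ℝ) :
    IsTLSSolution nx g b ↔ b = tlsEstimate nx g := by
  have hpos : ∀ b : Fin nx → ℝ, 0 < augment b ⬝ᵥ augment b := fun b => by
    rw [augment_dotProduct_self]
    linarith [dotProduct_self_nonneg b]
  -- Every correction feasible for `b` has squared norm at least the Rayleigh quotient of `HHᵀ` at
  -- `[b, 1]`; a rank-one correction attains it. The optimal value is therefore `σ²`.
  have hfeas : ∀ (b : Fin nx → ℝ) (D : Matrix (Fin (nx + 1)) (Fin (n - nx)) ℝ),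
      augment b ᵥ* (hankel nx g + D) = 0 →
      (augment b ᵥ* hankel nx g) ⬝ᵥ (augment b ᵥ* hankel nx g) ≤
        (augment b ⬝ᵥ augment b) * ∑ i, ∑ j, D i j ^ 2 := by
    intro b D hD
    rw [Matrix.vecMul_add] at hD
    rw [eq_neg_of_add_eq_zero_left hD, neg_dotProduct_neg]
    exact vecMul_dotProduct_self_le _ _
  have heig := tlsEstimate_eigenvector hlow hσ
  have hmin : (augment (tlsEstimate nx g) ᵥ* hankel nx g) ⬝ᵥ
      (augment (tlsEstimate nx g) ᵥ* hankel nx g) =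
      (augment (tlsEstimate nx g) ⬝ᵥ augment (tlsEstimate nx g)) * sigmaMin nx g ^ 2 := by
    rw [← Matrix.dotProduct_mulVec, heig, dotProduct_smul, smul_eq_mul, mul_comm]
  obtain ⟨D₀, hD₀, hD₀'⟩ := exists_correction (hankel nx g) (augment (tlsEstimate nx g)) (hpos _)
  have hD₀σ : ∑ i, ∑ j, D₀ i j ^ 2 = sigmaMin nx g ^ 2 :=
    mul_left_cancel₀ (hpos _).ne' (hD₀'.trans hmin)
  constructor
  · rintro ⟨D, hD, hDmin⟩
    have h1 := hDmin D₀ ⟨_, hD₀⟩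
    rw [frobNorm, frobNorm, Real.sqrt_le_sqrt_iff (by rw [hD₀σ]; positivity), hD₀σ] at h1
    have h2 := (hfeas b D hD).trans (mul_le_mul_of_nonneg_left h1 (hpos b).le)
    set S := hankel nx g * (hankel nx g)ᵀ -
      sigmaMin nx g ^ 2 • (1 : Matrix (Fin (nx + 1)) (Fin (nx + 1)) ℝ) with hS
    have hSmul : ∀ x, S *ᵥ x = hankel nx g *ᵥ (x ᵥ* hankel nx g) - sigmaMin nx g ^ 2 • x := by
      intro x
      rw [hS, Matrix.sub_mulVec, Matrix.smul_mulVec, Matrix.one_mulVec, ← Matrix.mulVec_mulVec,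
        Matrix.mulVec_transpose]
    have hSq : ∀ x, x ⬝ᵥ (S *ᵥ x) =
        (x ᵥ* hankel nx g) ⬝ᵥ (x ᵥ* hankel nx g) - sigmaMin nx g ^ 2 * (x ⬝ᵥ x) := by
      intro x
      rw [hSmul, dotProduct_sub, Matrix.dotProduct_mulVec, dotProduct_smul, smul_eq_mul]
    have hSpos : ∀ x, 0 ≤ x ⬝ᵥ (S *ᵥ x) := fun x => by
      rw [hSq, sub_nonneg]
      exact sq_sigmaMin_mul_le nx g x
    have hSsymm : Sᵀ = S := by
      rw [hS, Matrix.transpose_sub, Matrix.transpose_mul, Matrix.transpose_transpose,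
        Matrix.transpose_smul, Matrix.transpose_one]
    have hzero : augment b ⬝ᵥ (S *ᵥ augment b) = 0 := by
      refine le_antisymm ?_ (hSpos _)
      rw [hSq]
      linarith
    -- A null vector of a positive semidefinite form lies in its kernel: Cauchy–Schwarz against `S
    -- *ᵥ augment b`.
    have hker : S *ᵥ augment b = 0 := by
      have h3 := sq_dotProduct_mulVec_le hSsymm hSpos (S *ᵥ augment b) (augment b)
      rw [hzero, mul_zero] at h3
      exact dotProduct_self_eq_zero.1 (pow_eq_zero_iff two_ne_zero |>.1
        (le_antisymm h3 (sq_nonneg _)))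
    rw [hSmul, sub_eq_zero] at hker
    exact eq_tlsEstimate_of_eigenvector hlow hσ hker
  · rintro rfl
    refine ⟨D₀, hD₀, ?_⟩
    rintro D ⟨b', hb'⟩
    refine Real.sqrt_le_sqrt ?_
    rw [hD₀σ]
    refine le_of_mul_le_mul_left ?_ (hpos b')
    have h := sq_sigmaMin_mul_le nx g (augment b')
    rw [mul_comm] at h
    exact h.trans (hfeas b' D hb')

/-- The Rayleigh bound at `[a, 1]`, a vector of norm at least one. It makes `σ` vanish along with
the residual. -/
lemma sq_sigmaMin_le (nx : ℕ) {n : ℕ} (g : Fin n → ℝ) (a : Fin nx → ℝ) :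
    sigmaMin nx g ^ 2 ≤ (a ᵥ* hankelUp nx g + hankelLast nx g) ⬝ᵥ
      (a ᵥ* hankelUp nx g + hankelLast nx g) := by
  have h := sq_sigmaMin_mul_le nx g (augment a)
  rw [augment_vecMul_hankel, augment_dotProduct_self] at h
  nlinarith [mul_nonneg (sq_nonneg (sigmaMin nx g)) (dotProduct_self_nonneg a)]

/-- The error of the total least-squares estimate is bounded by the residual. -/
lemma tlsEstimate_bound (hκ : 0 < κ)
    (hlow : ∀ b : Fin nx → ℝ, κ * (b ⬝ᵥ b) ≤ (b ᵥ* hankelUp nx g) ⬝ᵥ (b ᵥ* hankelUp nx g))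
    (hσ : sigmaMin nx g ^ 2 ≤ κ / 4) (a : Fin nx → ℝ) :
    3 / 8 * κ * ((a - tlsEstimate nx g) ⬝ᵥ (a - tlsEstimate nx g)) ≤ (1 + a ⬝ᵥ a / 2) *
      ((a ᵥ* hankelUp nx g + hankelLast nx g) ⬝ᵥ (a ᵥ* hankelUp nx g + hankelLast nx g)) := by
  set U := hankelUp nx g
  set h := hankelLast nx g
  set d := tlsEstimate nx g
  set s := sigmaMin nx g ^ 2
  have hs : 0 ≤ s := sq_nonneg _
  have heq : U *ᵥ (d ᵥ* U) - s • d = -(U *ᵥ h) := gram_sub_mulVec_tlsEstimate hlow (by linarith)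
  have h1 : U *ᵥ ((a - d) ᵥ* U) = s • (a - d) + U *ᵥ (a ᵥ* U + h) - s • a := by
    rw [sub_eq_iff_eq_add] at heq
    rw [Matrix.sub_vecMul, Matrix.mulVec_sub, Matrix.mulVec_add, heq, smul_sub]
    abel
  have h2 : ((a - d) ᵥ* U) ⬝ᵥ ((a - d) ᵥ* U) = s * ((a - d) ⬝ᵥ (a - d)) +
      ((a - d) ᵥ* U) ⬝ᵥ (a ᵥ* U + h) - s * ((a - d) ⬝ᵥ a) := by
    rw [← Matrix.dotProduct_mulVec, h1, dotProduct_sub, dotProduct_add, dotProduct_smul,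
      dotProduct_smul, Matrix.dotProduct_mulVec]
    simp only [smul_eq_mul]
  -- With `e = a - d` and residual `r`, `h3` gives `eU·r ≤ ‖eU‖²/4 + ‖r‖²` and `h4` gives `-e·a ≤
  -- (‖e‖² + ‖a‖²)/2`. Hence `3/4 ‖eU‖² ≤ 3/2 s‖e‖² + ‖r‖² + s‖a‖²/2`; now `s ≤ κ/4` leaves `3/8
  -- κ‖e‖²` on the left, and `s ≤ ‖r‖²` handles the last term.
  have h3 := dotProduct_self_nonneg ((1 / 2 : ℝ) • ((a - d) ᵥ* U) - (a ᵥ* U + h))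
  have h4 := dotProduct_self_nonneg ((a - d) + a)
  have h5 := hlow (a - d)
  have h6 : s ≤ (a ᵥ* U + h) ⬝ᵥ (a ᵥ* U + h) := sq_sigmaMin_le nx g a
  set e := a - d
  set r := a ᵥ* U + h
  simp only [sub_dotProduct, dotProduct_sub, smul_dotProduct, dotProduct_smul, smul_eq_mul,
    dotProduct_comm r (e ᵥ* U)] at h3
  simp only [add_dotProduct, dotProduct_add, dotProduct_comm a e] at h4
  nlinarith [mul_nonneg hs h4, mul_le_mul_of_nonneg_right hσ (dotProduct_self_nonneg e),
    mul_le_mul_of_nonneg_right h6 (dotProduct_self_nonneg a)]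

end TotalLeastSquares

/-! ### The residual of the true coefficients -/

/-- By the Cayley–Hamilton theorem the characteristic polynomial annihilates the Markov
parameters. -/
lemma sum_augment_mul_markov {nx : ℕ} (A : Matrix (Fin nx) (Fin nx) ℝ) (B C : Fin nx → ℝ)
    (j : ℕ) : ∑ i : Fin (nx + 1), augment (charCoeffs A) i * markov A B C (i + j) = 0 := by
  have h := Matrix.aeval_self_charpoly A
  rw [Polynomial.aeval_eq_sum_range, Matrix.charpoly_natDegree_eq_dim, Fintype.card_fin,
    Finset.sum_range] at h
  have h1 : C ⬝ᵥ (((∑ i : Fin (nx + 1), A.charpoly.coeff i • A ^ (i : ℕ)) * A ^ j) *ᵥ B) = 0 := by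
    rw [h]
    simp
  simp only [augment_charCoeffs, markov, pow_add]
  rw [← h1, Finset.sum_mul, Matrix.sum_mulVec, dotProduct_sum]
  refine Finset.sum_congr rfl fun i _ => ?_
  rw [Matrix.smul_mul, Matrix.smul_mulVec, dotProduct_smul, smul_eq_mul]

/-- The residual of the true coefficients is bounded by the error of the Markov parameters. -/
lemma residual_le {nx : ℕ} (A : Matrix (Fin nx) (Fin nx) ℝ) (B C : Fin nx → ℝ) {n : ℕ}
    (g : Fin n → ℝ) :
    (charCoeffs A ᵥ* hankelUp nx g + hankelLast nx g) ⬝ᵥ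
        (charCoeffs A ᵥ* hankelUp nx g + hankelLast nx g) ≤
      (augment (charCoeffs A) ⬝ᵥ augment (charCoeffs A) * (nx + 1)) *
        ‖WithLp.toLp 2 (g - markovVec A B C n)‖ ^ 2 := by
  set e := g - markovVec A B C n with he
  have h1 : charCoeffs A ᵥ* hankelUp nx g + hankelLast nx g =
      augment (charCoeffs A) ᵥ* hankel nx e := by
    rw [← augment_vecMul_hankel]
    ext j
    have h := sum_augment_mul_markov A B C j
    simp only [Matrix.vecMul, dotProduct, hankel, Matrix.of_apply, he, Pi.sub_apply, markovVec,
      mul_sub, Finset.sum_sub_distrib]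
    rw [h, sub_zero]
  -- Each of the `nx + 1` rows is a window of consecutive entries of the error vector.
  have h2 : ∑ i, ∑ j, hankel nx e i j ^ 2 ≤ (nx + 1) * (e ⬝ᵥ e) := by
    calc ∑ i, ∑ j, hankel nx e i j ^ 2 ≤ ∑ _i : Fin (nx + 1), e ⬝ᵥ e := by
          refine Finset.sum_le_sum fun i _ => ?_
          let f : Fin (n - nx) ↪ Fin n :=
            ⟨fun j => ⟨(i : ℕ) + (j : ℕ), by omega⟩, fun j k h => by
              have := congrArg Fin.val h
              exact Fin.ext (by simp only at this; omega)⟩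
          calc ∑ j, hankel nx e i j ^ 2 = ∑ k ∈ Finset.univ.map f, e k ^ 2 := by
                rw [Finset.sum_map]
                rfl
            _ ≤ ∑ k, e k ^ 2 := Finset.sum_le_univ_sum_of_nonneg fun k => sq_nonneg _
            _ = e ⬝ᵥ e := by simp [dotProduct, sq]
      _ = (nx + 1) * (e ⬝ᵥ e) := by simp
  rw [h1, norm_toLp_sq, mul_assoc]
  exact (vecMul_dotProduct_self_le _ _).trans
    (mul_le_mul_of_nonneg_left h2 (dotProduct_self_nonneg _))

/-! ### Lower bounds from controllability and observability -/

lemma isUnit_of_rank_eq {k : ℕ} {M : Matrix (Fin k) (Fin k) ℝ} (h : M.rank = k) : IsUnit M := by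
  rw [← Matrix.linearIndependent_rows_iff_isUnit, linearIndependent_iff_card_eq_finrank_span,
    Fintype.card_fin, Set.finrank, ← Matrix.rank_eq_finrank_span_row, h]

lemma obsvMatrix_mul_ctrbMatrix_apply {nx : ℕ} (A : Matrix (Fin nx) (Fin nx) ℝ)
    (B C : Fin nx → ℝ) (i j : Fin nx) :
    (obsvMatrix A C * ctrbMatrix A B) i j = markov A B C (i + j) := by
  rw [markov, pow_add, ← Matrix.mulVec_mulVec, Matrix.dotProduct_mulVec]
  rfl

/-- Matrices converging to an invertible one are eventually uniformly bounded below. -/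
lemma exists_pos_eventually_mul_le {k : ℕ} {F : ℕ → Matrix (Fin k) (Fin k) ℝ}
    {M : Matrix (Fin k) (Fin k) ℝ} (hF : Tendsto F atTop (𝓝 M)) (hM : IsUnit M) :
    ∃ κ : ℝ, 0 < κ ∧ ∀ᶠ N in atTop, ∀ b : Fin k → ℝ,
      κ * (b ⬝ᵥ b) ≤ (b ᵥ* F N) ⬝ᵥ (b ᵥ* F N) := by
  have hdet : Tendsto (fun N => (F N).det) atTop (𝓝 M.det) :=
    ((continuous_id.matrix_det).tendsto M).comp hF
  have hMdet : M.det ≠ 0 := ((Matrix.isUnit_iff_isUnit_det M).1 hM).ne_zero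
  have hinv : Tendsto (fun N => (F N)⁻¹) atTop (𝓝 M⁻¹) := by
    simp only [Matrix.inv_def, Ring.inverse_eq_inv']
    exact (hdet.inv₀ hMdet).smul (((continuous_id.matrix_adjugate).tendsto M).comp hF)
  have hsum : Tendsto (fun N => ∑ i, ∑ j, (F N)⁻¹ i j ^ 2) atTop
      (𝓝 (∑ i, ∑ j, M⁻¹ i j ^ 2)) := by
    refine tendsto_finsetSum _ fun i _ => tendsto_finsetSum _ fun j _ => Tendsto.pow ?_ 2
    exact tendsto_pi_nhds.1 (tendsto_pi_nhds.1 hinv i) j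
  have hL : 0 ≤ ∑ i, ∑ j, M⁻¹ i j ^ 2 :=
    Finset.sum_nonneg fun i _ => Finset.sum_nonneg fun j _ => sq_nonneg _
  set L := ∑ i, ∑ j, M⁻¹ i j ^ 2
  refine ⟨(L + 1)⁻¹, by positivity, ?_⟩
  filter_upwards [hdet.eventually_ne hMdet, hsum.eventually_lt_const (lt_add_one L)]
    with N hN1 hN2 b
  -- Recover `b = (b F) F⁻¹` and bound `F⁻¹` by its Frobenius norm, whose square is eventually below
  -- `L + 1`.
  have h := vecMul_dotProduct_self_le (b ᵥ* F N) (F N)⁻¹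
  rw [Matrix.vecMul_vecMul, Matrix.mul_nonsing_inv _ hN1.isUnit, Matrix.vecMul_one] at h
  rw [inv_mul_le_iff₀ (by positivity), mul_comm (L + 1)]
  exact h.trans (mul_le_mul_of_nonneg_left hN2.le (dotProduct_self_nonneg _))

section Asymptotics

variable {nx : ℕ} {A : Matrix (Fin nx) (Fin nx) ℝ} {B C : Fin nx → ℝ} {n : ℕ → ℕ}
  {g : ∀ N : ℕ, Fin (n N) → ℝ}

/-- If the weights control the first `nx` coordinates, the weighted quadratic form is eventually
uniformly bounded below on the row space of `H⁺`. -/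
lemma exists_pos_eventually_weighted_le (hctrb : (ctrbMatrix A B).rank = nx)
    (hobsv : (obsvMatrix A C).rank = nx) (hn : Tendsto n atTop atTop)
    (hg : Tendsto (fun N => ‖WithLp.toLp 2 (g N - markovVec A B C (n N))‖) atTop (𝓝 0))
    (W : ∀ N, Matrix (Fin (n N - nx)) (Fin (n N - nx)) ℝ) {κ' : ℝ} (hκ' : 0 < κ')
    (hW : ∀ᶠ N in atTop, ∀ (v : Fin (n N - nx) → ℝ) (i : Fin (n N - nx)), (i : ℕ) < nx →
      κ' * v i ^ 2 ≤ v ⬝ᵥ (W N *ᵥ v)) :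
    ∃ κ : ℝ, 0 < κ ∧ ∀ᶠ N in atTop, ∀ b : Fin nx → ℝ,
      κ * (b ⬝ᵥ b) ≤ (b ᵥ* hankelUp nx (g N)) ⬝ᵥ (W N *ᵥ (b ᵥ* hankelUp nx (g N))) := by
  -- The leading square block of `H⁺`. The default zero makes it defined for every `N` and is never
  -- used once `n N ≥ 2 * nx`.
  set F : ℕ → Matrix (Fin nx) (Fin nx) ℝ := fun N =>
    Matrix.of fun i j => if h : (i : ℕ) + j < n N then g N ⟨i + j, h⟩ else 0 with hFdef
  have hF : Tendsto F atTop (𝓝 (obsvMatrix A C * ctrbMatrix A B)) := by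
    refine tendsto_pi_nhds.2 fun i => tendsto_pi_nhds.2 fun j => ?_
    rw [obsvMatrix_mul_ctrbMatrix_apply]
    refine tendsto_iff_norm_sub_tendsto_zero.2 ?_
    refine squeeze_zero' (Eventually.of_forall fun N => norm_nonneg _) ?_ hg
    filter_upwards [hn.eventually_ge_atTop (2 * nx)] with N hN
    have hlt : (i : ℕ) + j < n N := by omega
    have h := PiLp.norm_apply_le (WithLp.toLp 2 (g N - markovVec A B C (n N))) ⟨i + j, hlt⟩
    simpa [hFdef, hlt, markovVec] using h
  obtain ⟨κ, hκ, h⟩ := exists_pos_eventually_mul_le hF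
    ((isUnit_of_rank_eq hobsv).mul (isUnit_of_rank_eq hctrb))
  refine ⟨κ * κ' / (nx + 1), by positivity, ?_⟩
  filter_upwards [h, hW, hn.eventually_ge_atTop (2 * nx)] with N hN1 hN2 hN3 b
  set v := b ᵥ* hankelUp nx (g N) with hv
  have hle : nx ≤ n N - nx := by omega
  have hvF : ∀ j : Fin nx, (b ᵥ* F N) j = v (Fin.castLE hle j) := by
    intro j
    simp only [hv, Matrix.vecMul, dotProduct]
    refine Finset.sum_congr rfl fun i _ => ?_
    have hlt : (i : ℕ) + j < n N := by omega
    simp [hFdef, hankelUp, hankel, hlt]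
  have h1 : κ' * ((b ᵥ* F N) ⬝ᵥ (b ᵥ* F N)) ≤ nx * (v ⬝ᵥ (W N *ᵥ v)) := by
    rw [dotProduct, Finset.mul_sum]
    calc ∑ j, κ' * ((b ᵥ* F N) j * (b ᵥ* F N) j) ≤ ∑ _j : Fin nx, v ⬝ᵥ (W N *ᵥ v) := by
          refine Finset.sum_le_sum fun j _ => ?_
          rw [hvF, ← sq]
          exact hN2 v _ j.2
      _ = nx * (v ⬝ᵥ (W N *ᵥ v)) := by simp
  have h2 := mul_le_mul_of_nonneg_left (hN1 b) hκ'.le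
  have h3 : 0 ≤ κ' * (κ * (b ⬝ᵥ b)) := by
    have := dotProduct_self_nonneg b
    positivity
  have h4 : (0 : ℝ) ≤ nx := Nat.cast_nonneg nx
  rw [div_mul_eq_mul_div, div_le_iff₀ (by positivity)]
  -- The weights are not assumed positive semidefinite here: for `nx > 0` nonnegativity of the form
  -- follows from `h1`, and for `nx = 0` the vector `b` is zero. The denominator `nx + 1` covers
  -- both cases.
  rcases h4.eq_or_lt with h5 | h5
  · have h6 : b = 0 := by
      have h7 : nx = 0 := by exact_mod_cast h5.symm
      subst h7
      exact Subsingleton.elim _ _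
    simp [hv, h6]
  · have h6 : 0 ≤ v ⬝ᵥ (W N *ᵥ v) := by
      by_contra hcon
      nlinarith
    nlinarith

/-! ### Uniqueness and convergence along a sequence -/

lemma tendsto_of_mul_dotProduct_le {k : ℕ} {x : ℕ → Fin k → ℝ} {a : Fin k → ℝ} {c K : ℝ}
    (hc : 0 < c) {ρ : ℕ → ℝ} (hρ : Tendsto ρ atTop (𝓝 0))
    (h : ∀ᶠ N in atTop, c * ((a - x N) ⬝ᵥ (a - x N)) ≤ K * ρ N) :
    Tendsto x atTop (𝓝 a) := by
  refine tendsto_pi_nhds.2 fun i => tendsto_iff_norm_sub_tendsto_zero.2 ?_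
  have h1 : Tendsto (fun N => √(c⁻¹ * (K * ρ N))) atTop (𝓝 0) := by
    simpa using ((hρ.const_mul K).const_mul c⁻¹).sqrt
  refine squeeze_zero' (Eventually.of_forall fun N => norm_nonneg _) ?_ h1
  filter_upwards [h] with N hN
  refine Real.le_sqrt_of_sq_le ?_
  rw [Real.norm_eq_abs, sq_abs, le_inv_mul_iff₀ hc]
  refine le_trans (mul_le_mul_of_nonneg_left ?_ hc.le) hN
  have h2 := sq_apply_le_dotProduct_self (a - x N) i
  rwa [Pi.sub_apply, ← neg_sub, neg_sq] at h2

/-- Uniqueness and consistency along one sequence of weights. -/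
lemma wls_eventually_unique_and_tendsto (hctrb : (ctrbMatrix A B).rank = nx)
    (hobsv : (obsvMatrix A C).rank = nx) (hn : Tendsto n atTop atTop)
    (hg : Tendsto (fun N => ‖WithLp.toLp 2 (g N - markovVec A B C (n N))‖) atTop (𝓝 0))
    (W : ∀ N, Matrix (Fin (n N - nx)) (Fin (n N - nx)) ℝ) {κ' K : ℝ} (hκ' : 0 < κ') (hK : 0 ≤ K)
    (hW : ∀ᶠ N in atTop, (W N)ᵀ = W N ∧ (∀ v, 0 ≤ v ⬝ᵥ (W N *ᵥ v)) ∧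
      (∀ v, v ⬝ᵥ (W N *ᵥ v) ≤ K * (v ⬝ᵥ v)) ∧
      ∀ (v : Fin (n N - nx) → ℝ) (i : Fin (n N - nx)), (i : ℕ) < nx →
        κ' * v i ^ 2 ≤ v ⬝ᵥ (W N *ᵥ v)) :
    (∀ᶠ N in atTop, ∀ b, IsWLSSolution nx (W N) (g N) b ↔ b = wlsEstimate nx (W N) (g N)) ∧
      Tendsto (fun N => wlsEstimate nx (W N) (g N)) atTop (𝓝 (charCoeffs A)) := by
  obtain ⟨κ, hκ, hlow⟩ := exists_pos_eventually_weighted_le hctrb hobsv hn hg W hκ'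
    (hW.mono fun N hN => hN.2.2.2)
  refine ⟨?_, tendsto_of_mul_dotProduct_le hκ
    (K := K * (augment (charCoeffs A) ⬝ᵥ augment (charCoeffs A) * (nx + 1)))
    (ρ := fun N => ‖WithLp.toLp 2 (g N - markovVec A B C (n N))‖ ^ 2) (by simpa using hg.pow 2) ?_⟩
  · filter_upwards [hW, hlow] with N hN1 hN2
    exact (wls_unique_and_bound hN1.1 hN1.2.1 (g N) hκ hN2).1
  · filter_upwards [hW, hlow] with N hN1 hN2
    have h1 := (wls_unique_and_bound hN1.1 hN1.2.1 (g N) hκ hN2).2 (charCoeffs A)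
    rw [mul_assoc]
    exact h1.trans ((hN1.2.2.1 _).trans
      (mul_le_mul_of_nonneg_left (residual_le A B C (g N)) hK))

lemma ols_eventually_unique_and_tendsto (hctrb : (ctrbMatrix A B).rank = nx)
    (hobsv : (obsvMatrix A C).rank = nx) (hn : Tendsto n atTop atTop)
    (hg : Tendsto (fun N => ‖WithLp.toLp 2 (g N - markovVec A B C (n N))‖) atTop (𝓝 0)) :
    (∀ᶠ N in atTop, ∀ b, IsOLSSolution nx (g N) b ↔ b = olsEstimate nx (g N)) ∧
      Tendsto (fun N => olsEstimate nx (g N)) atTop (𝓝 (charCoeffs A)) := by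
  simp only [isOLSSolution_iff_isWLSSolution, olsEstimate_eq_wlsEstimate]
  refine wls_eventually_unique_and_tendsto hctrb hobsv hn hg (fun N => 1) one_pos zero_le_one
    (Eventually.of_forall fun N => ⟨Matrix.transpose_one, fun v => ?_, fun v => ?_, fun v i _ => ?_⟩)
  · rw [Matrix.one_mulVec]
    exact dotProduct_self_nonneg v
  · rw [Matrix.one_mulVec, one_mul]
  · rw [Matrix.one_mulVec, one_mul]
    exact sq_apply_le_dotProduct_self v i

lemma tls_eventually_unique_and_tendsto (hctrb : (ctrbMatrix A B).rank = nx)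
    (hobsv : (obsvMatrix A C).rank = nx) (hn : Tendsto n atTop atTop)
    (hg : Tendsto (fun N => ‖WithLp.toLp 2 (g N - markovVec A B C (n N))‖) atTop (𝓝 0)) :
    (∀ᶠ N in atTop, ∀ b, IsTLSSolution nx (g N) b ↔ b = tlsEstimate nx (g N)) ∧
      Tendsto (fun N => tlsEstimate nx (g N)) atTop (𝓝 (charCoeffs A)) := by
  obtain ⟨κ, hκ, hlow⟩ := exists_pos_eventually_weighted_le hctrb hobsv hn hg (fun N => 1) one_pos
    (Eventually.of_forall fun N v i _ => by
      rw [Matrix.one_mulVec, one_mul]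
      exact sq_apply_le_dotProduct_self v i)
  simp only [Matrix.one_mulVec] at hlow
  have hρ : Tendsto (fun N => ‖WithLp.toLp 2 (g N - markovVec A B C (n N))‖ ^ 2) atTop (𝓝 0) := by
    simpa using hg.pow 2
  -- The residual tends to zero while `κ` is fixed, so the singular value eventually meets the
  -- threshold of `tlsEstimate_bound`.
  have hσ : ∀ᶠ N in atTop, sigmaMin nx (g N) ^ 2 ≤ κ / 4 := by
    have h := hρ.const_mul (augment (charCoeffs A) ⬝ᵥ augment (charCoeffs A) * (nx + 1))
    rw [mul_zero] at h
    filter_upwards [h.eventually_le_const (show 0 < κ / 4 by positivity)] with N hN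
    exact (sq_sigmaMin_le nx (g N) (charCoeffs A)).trans ((residual_le A B C (g N)).trans hN)
  refine ⟨?_, tendsto_of_mul_dotProduct_le (c := 3 / 8 * κ) (by positivity)
    (K := (1 + charCoeffs A ⬝ᵥ charCoeffs A / 2) *
      (augment (charCoeffs A) ⬝ᵥ augment (charCoeffs A) * (nx + 1))) hρ ?_⟩
  · filter_upwards [hlow, hσ] with N hN1 hN2
    exact isTLSSolution_iff hN1 (by linarith)
  · filter_upwards [hlow, hσ] with N hN1 hN2
    rw [mul_assoc (1 + charCoeffs A ⬝ᵥ charCoeffs A / 2)]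
    refine (tlsEstimate_bound hκ hN1 hN2 (charCoeffs A)).trans
      (mul_le_mul_of_nonneg_left (residual_le A B C (g N)) ?_)
    have := dotProduct_self_nonneg (charCoeffs A)
    positivity

end Asymptotics

end Realization

theorem theorem2 {Ω : Type*} [MeasurableSpace Ω] (μ : Measure Ω) [IsProbabilityMeasure μ]
    {nx : ℕ} (A : Matrix (Fin nx) (Fin nx) ℝ) (B C : Fin nx → ℝ)
    (hsys : Realization.IsStableMinimal A B C)
    (n : ℕ → ℕ) (hn : Realization.OrderGrowth A B C n)
    (ghat : ∀ N : ℕ, Ω → Fin (n N) → ℝ)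
    (hghat : ∀ᵐ ω ∂μ, Tendsto
      (fun N => ‖WithLp.toLp 2 (ghat N ω - Realization.markovVec A B C (n N))‖) atTop (𝓝 0))
    (P : ∀ N : ℕ, Matrix (Fin (n N)) (Fin (n N)) ℝ)
    (hP : Realization.RegularCovariance n P) :
    -- almost surely, for all large `N`, each estimate is the unique solution of its problem
    (∀ᵐ ω ∂μ, ∀ᶠ N in atTop, ∀ b : Fin nx → ℝ,
      (Realization.IsOLSSolution nx (ghat N ω) b ↔
        b = Realization.olsEstimate nx (ghat N ω)) ∧
      (Realization.IsTLSSolution nx (ghat N ω) b ↔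
        b = Realization.tlsEstimate nx (ghat N ω)) ∧
      (Realization.IsWLSSolution nx
          (Realization.weight (P N) (Realization.charCoeffs A)) (ghat N ω) b ↔
        b = Realization.wlsEstimate nx
          (Realization.weight (P N) (Realization.charCoeffs A)) (ghat N ω))) ∧
    -- strong consistency of the three estimates
    (∀ᵐ ω ∂μ, Tendsto (fun N => Realization.olsEstimate nx (ghat N ω)) atTop
      (𝓝 (Realization.charCoeffs A))) ∧
    (∀ᵐ ω ∂μ, Tendsto (fun N => Realization.tlsEstimate nx (ghat N ω)) atTop
      (𝓝 (Realization.charCoeffs A))) ∧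
    (∀ᵐ ω ∂μ, Tendsto (fun N => Realization.wlsEstimate nx
        (Realization.weight (P N) (Realization.charCoeffs A)) (ghat N ω)) atTop
      (𝓝 (Realization.charCoeffs A))) := by
  obtain ⟨K, κ, hK, hκ, hW⟩ := Realization.exists_weight_bounds A hsys.stable n P hP
  have hW' : ∀ᶠ N in atTop, _ := (hn.tendsto_atTop.eventually_ge_atTop nx).mono hW
  have hols := fun ω hω => Realization.ols_eventually_unique_and_tendsto (g := fun N => ghat N ω)
    hsys.controllable hsys.observable hn.tendsto_atTop hω
  have htls := fun ω hω => Realization.tls_eventually_unique_and_tendsto (g := fun N => ghat N ω)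
    hsys.controllable hsys.observable hn.tendsto_atTop hω
  have hwls := fun ω hω => Realization.wls_eventually_unique_and_tendsto (g := fun N => ghat N ω)
    hsys.controllable hsys.observable hn.tendsto_atTop hω _ hκ hK hW'
  refine ⟨?_, hghat.mono fun ω hω => (hols ω hω).2, hghat.mono fun ω hω => (htls ω hω).2,
    hghat.mono fun ω hω => (hwls ω hω).2⟩
  filter_upwards [hghat] with ω hω
  filter_upwards [(hols ω hω).1, (htls ω hω).1, (hwls ω hω).1] with N h1 h2 h3 b
  exact ⟨h1 b, h2 b, h3 b⟩
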